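/- For a permutation $\pi$ of $[n]=\{1,\dots,n\}$, the standard cycle notation of $\pi$ writes every cycle (fixed points included) with its largest element first, followed by its successive images under $\pi$, and lists the cycles in increasing order of their largest elements. The fundamental bijection $\theta:S_n\to S_n$ sends $\pi$ to the permutation $\theta(\pi)$ whose one-line notation is obtained from the standard cycle notation of $\pi$ by removing the parentheses. A permutation avoids $321$ if its one-line notation has no decreasing subsequence of length $3$. Let $\mathcal T_n(321)$ be the set of all $\pi\in S_n$ such that both $\pi$ and $\theta(\pi)$ avoid $321$, let $t_n(321)=|\mathcal T_n(321)|$, and let $$T_{321}(x)=\sum_{n\ge 1}t_n(321)\,x^n .$$ Then $$T_{321}(x)=\frac{2x^2}{2x(1-x)-1+\sqrt{1-4x^2}},$$ as an identity of formal Laurent series over $\mathbb Q$, where $\sqrt{1-4x^2}$ is the formal power series with constant term $1$ whose square is $1-4x^2$ (the denominator being nonzero). Moreover, call $\pi\in S_n$ reducible if $\pi=\sigma\oplus\tau$ for some $\sigma\in S_{n-k}$, $\tau\in S_k$ with $1\le k\le n-1$, where $(\sigma\oplus\tau)(i)=\sigma(i)$ for $i\le n-k$ and $(\sigma\oplus\tau)(i)=\tau(i-(n-k))+(n-k)$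 for $i>n-k$; otherwise call it irreducible. Then for every $n\ge 2$ the number of irreducible permutations in $\mathcal T_n(321)$ is $$a_n(321)=\binom{n-2}{\lfloor (n-2)/2\rfloor}.$$ -/

import Mathlib

namespace FundamentalBijection

open Equiv

/-! ### Pattern avoidance -/

/-- `π` contains the pattern `τ`: there are positions `i₁ < ⋯ < iₖ` (the values of the order
embedding `f`) at which the entries of `π` are in the same relative order as those of `τ`. -/
def Contains {n k : ℕ} (π : Perm (Fin n)) (τ : Perm (Fin k)) : Prop :=
  ∃ f : Fin k ↪o Fin n, ∀ r s : Fin k, π (f r) < π (f s) ↔ τ r < τ s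

/-- `π` avoids the pattern `τ`. -/
def Avoids {n k : ℕ} (π : Perm (Fin n)) (τ : Perm (Fin k)) : Prop :=
  ¬ Contains π τ

/-- The pattern `321` (with the letters `1, 2, 3` written as `0, 1, 2 : Fin 3`). -/
def pattern321 : Perm (Fin 3) := Fin.revPerm

/-! ### Standard cycle notation and the fundamental bijection -/

/-- `m` is the largest element of its cycle in `π`. -/
def IsCycleMax {n : ℕ} (π : Perm (Fin n)) (m : Fin n) : Prop :=
  ∀ j : Fin n, π.SameCycle m j → j ≤ m

instance {n : ℕ} (π : Perm (Fin n)) : DecidablePred (IsCycleMax π) :=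
  fun m => inferInstanceAs (Decidable (∀ j : Fin n, π.SameCycle m j → j ≤ m))

/-- The cycle of `π` through `m`, written starting at `m`, that is `m, π m, π (π m), …`.
(Mathlib's `Equiv.Perm.toList` is empty at fixed points, whence the case distinction.) -/
def cycleFrom {n : ℕ} (π : Perm (Fin n)) (m : Fin n) : List (Fin n) :=
  if π m = m then [m] else π.toList m

/-- The standard cycle notation of `π` with the parentheses removed: every cycle starts with its
largest element, and the cycles are listed in increasing order of their largest elements. -/
def standardCycleWord {n : ℕ} (π : Perm (Fin n)) : List (Fin n) :=
  ((List.finRange n).filter (fun m => IsCycleMax π m)).flatMap (cycleFrom π)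

theorem mem_cycleFrom {n : ℕ} {π : Perm (Fin n)} {m x : Fin n} :
    x ∈ cycleFrom π m ↔ π.SameCycle m x := by
  unfold cycleFrom
  split_ifs with h
  · rw [List.mem_singleton]
    constructor
    · rintro rfl
      exact Perm.SameCycle.refl _ _
    · intro hx
      exact (hx.eq_of_left h).symm
  · rw [Perm.mem_toList_iff, Perm.mem_support]
    exact ⟨fun hx => hx.1, fun hx => ⟨hx, h⟩⟩

theorem nodup_standardCycleWord {n : ℕ} (π : Perm (Fin n)) : (standardCycleWord π).Nodup := by
  unfold standardCycleWord
  rw [List.nodup_flatMap]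
  constructor
  · intro m _
    unfold cycleFrom
    split_ifs
    · exact List.nodup_singleton m
    · exact Perm.nodup_toList π m
  · have hnd : ((List.finRange n).filter (fun m => IsCycleMax π m)).Nodup :=
      (List.nodup_finRange n).filter _
    refine List.Pairwise.imp_of_mem ?_ hnd
    intro a b ha hb hab x hxa hxb
    have ha' : IsCycleMax π a := by simpa using (List.mem_filter.1 ha).2
    have hb' : IsCycleMax π b := by simpa using (List.mem_filter.1 hb).2
    have h : π.SameCycle a b := (mem_cycleFrom.1 hxa).trans (mem_cycleFrom.1 hxb).symm
    exact hab (le_antisymm (hb' a h.symm) (ha' b h))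

theorem mem_standardCycleWord {n : ℕ} (π : Perm (Fin n)) (x : Fin n) :
    x ∈ standardCycleWord π := by
  classical
  unfold standardCycleWord
  rw [List.mem_flatMap]
  let s : Finset (Fin n) := Finset.univ.filter (fun j => π.SameCycle x j)
  have hs : s.Nonempty := ⟨x, by simp [s, Perm.SameCycle.refl]⟩
  have hm : π.SameCycle x (s.max' hs) := by
    have := s.max'_mem hs
    simpa [s] using this
  refine ⟨s.max' hs, ?_, mem_cycleFrom.2 hm.symm⟩
  rw [List.mem_filter]
  refine ⟨List.mem_finRange _, ?_⟩
  rw [decide_eq_true_eq]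
  intro j hj
  exact s.le_max' j (by simpa [s] using hm.trans hj)

theorem length_standardCycleWord {n : ℕ} (π : Perm (Fin n)) :
    (standardCycleWord π).length = n := by
  have h := Fintype.card_congr
    (List.Nodup.getEquivOfForallMemList _ (nodup_standardCycleWord π) (mem_standardCycleWord π))
  simpa using h

/-- The fundamental bijection `θ`: the one-line notation of `theta π` is the standard cycle
notation of `π` with the parentheses removed. -/
def theta {n : ℕ} (π : Perm (Fin n)) : Perm (Fin n) :=
  (finCongr (length_standardCycleWord π).symm).trans
    (List.Nodup.getEquivOfForallMemList _ (nodup_standardCycleWord π) (mem_standardCycleWord π))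

/-- The one-line notation of `theta π` is the standard cycle word of `π`. -/
theorem ofFn_theta {n : ℕ} (π : Perm (Fin n)) :
    List.ofFn (theta π) = standardCycleWord π := by
  apply List.ext_getElem
  · simp [length_standardCycleWord]
  · intro i h₁ h₂
    simp [theta]

/-- The set `𝒯ₙ(σ)` of all `π ∈ Sₙ` such that both `π` and `θ(π)` avoid `σ`. -/
def avoidingSet {k : ℕ} (n : ℕ) (σ : Perm (Fin k)) : Set (Perm (Fin n)) :=
  {π | Avoids π σ ∧ Avoids (theta π) σ}

/-- `tₙ(σ)`, the number of elements of `𝒯ₙ(σ)`. -/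
noncomputable def t {k : ℕ} (n : ℕ) (σ : Perm (Fin k)) : ℕ :=
  (avoidingSet n σ).ncard

/-- The generating function `T_σ(x) = ∑_{n ≥ 1} tₙ(σ) xⁿ`. -/
noncomputable def genFun {k : ℕ} (σ : Perm (Fin k)) : PowerSeries ℚ :=
  PowerSeries.mk fun n => if n = 0 then 0 else (t n σ : ℚ)

/-! ### Direct sums and irreducible permutations -/

/-- The direct sum `σ ⊕ τ`: it acts as `σ` on the first `a` letters and as (a shift of) `τ` on the
last `b` letters. -/
def directSum {a b : ℕ} (σ : Perm (Fin a)) (τ : Perm (Fin b)) : Perm (Fin (a + b)) :=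
  finSumFinEquiv.permCongr (Perm.sumCongr σ τ)

/-- `π` is a direct sum of two permutations of positive size. -/
def Reducible {n : ℕ} (π : Perm (Fin n)) : Prop :=
  ∃ (a b : ℕ) (h : a + b = n) (σ : Perm (Fin a)) (τ : Perm (Fin b)),
    1 ≤ a ∧ 1 ≤ b ∧ π = (finCongr h).permCongr (directSum σ τ)

/-- The number `aₙ(σ)` of irreducible permutations in `𝒯ₙ(σ)`. -/
noncomputable def irreducibleCount {k : ℕ} (n : ℕ) (σ : Perm (Fin k)) : ℕ :=
  {π ∈ avoidingSet n σ | ¬ Reducible π}.ncard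

end FundamentalBijection

namespace FundamentalBijection

open Equiv

/-! ### Lattice paths whose flat steps lie at height at most one -/

/-! Call `j` a closer of `π` if `π j < j`, an opener if `j < π⁻¹ j`. A 321-avoiding `π` is
increasing on its closers and on its non-closers. If `θ(π)` also avoids 321, every nontrivial cycle
climbs from its minimum to its maximum and drops back in a single step, so it has one opener (its
minimum) and one closer (its maximum). Scan the letters in order and write an up step at an opener,
a down step at a closer, a flat step elsewhere. The height is then the number of open cycles, and
flat steps occur only at height 0 (fixed points) or 1 (interior points of the unique open cycle).

Conversely the path determines `π`: closers go to openers in order, the other letters to the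
non-openers in order. This gives a bijection with the paths from 0 to 0 whose flat steps lie at
height at most 1 (`mem_avoidingSet_iff`, `permWord_injOn`, `exists_permWord_eq`). A proper prefix is
invariant under `π` exactly where the path returns to 0, so the irreducible permutations are the
paths positive in between (`IsTame.not_reducible_iff`).

Those paths are counted by central entries of Pascal's triangle (`pathCount_true_succ_succ`).
Writing `B` for the series of these entries and `P` for that of all paths, cutting at the first
return to 0 gives `P (1 - x - x²B) = 1`, and `√(1 - 4x²) = (1 - 2x)(1 + 2xB)` turns this into the
stated formula. -/

/-- The number of lattice paths with `n` steps from height `h` to height `0`, all of whose flat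
steps lie at height `0` or `1`. If `s` holds, the path must end when it first reaches height
`0`. -/
def pathCount (s : Bool) : ℕ → ℕ → ℕ
  | 0, 0 => 1
  | 0, _ + 1 => 0
  | n + 1, 0 => if s then 0 else pathCount s n 0 + pathCount s n 1
  | n + 1, 1 => pathCount s n 0 + pathCount s n 1 + pathCount s n 2
  | n + 1, h + 2 => pathCount s n (h + 1) + pathCount s n (h + 3)

theorem pathCount_true_succ_zero (n : ℕ) : pathCount true (n + 1) 0 = 0 := by
  simp [pathCount]

/-- First passage paths are counted by the entries of Pascal's triangle. -/
theorem pathCount_true_succ_succ (n h : ℕ) :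
    pathCount true (n + 1) (h + 1) = if h ≤ n then n.choose ((n - h) / 2) else 0 := by
  -- The last step is a forced descent from 1 to 0. The rest is a walk on the positive integers with
  -- a loop at 1, the quotient of the simple walk on `ℤ` by the reflection exchanging 1 and 0. So
  -- one counts simple walks of length `n` from `h + 1` to 1 or 0; parity admits one of these
  -- endpoints, whence the floor. The induction itself is Pascal's rule.
  induction n generalizing h with
  | zero => cases h <;> simp [pathCount]
  | succ n ih =>
    rcases h with _ | h
    · rw [zero_add, pathCount, pathCount_true_succ_zero, ih 0, ih 1]
      rcases Nat.even_or_odd' n with ⟨k, rfl | rfl⟩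
      · rcases k with _ | k
        · simp
        · have h1 : (2 * (k + 1) - 0) / 2 = k + 1 := by lia
          have h2 : (2 * (k + 1) - 1) / 2 = k := by lia
          have h3 : (2 * (k + 1) + 1 - 0) / 2 = k + 1 := by lia
          rw [if_pos (by lia), if_pos (by lia), if_pos (by lia), h1, h2, h3,
            Nat.choose_succ_succ (2 * (k + 1)) k]
          ring
      · have h1 : (2 * k + 1 - 0) / 2 = k := by lia
        have h2 : (2 * k + 1 - 1) / 2 = k := by lia
        have h3 : (2 * k + 1 + 1 - 0) / 2 = k + 1 := by lia
        rw [if_pos (by lia), if_pos (by lia), if_pos (by lia), h1, h2, h3,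
          Nat.choose_succ_succ (2 * k + 1) k, ← Nat.choose_symm_half k]
        ring
    · rw [pathCount, ih h, ih (h + 2)]
      by_cases h1 : h + 2 ≤ n
      · obtain ⟨d, rfl⟩ := Nat.exists_eq_add_of_le h1
        have e1 : (h + 2 + d - h) / 2 = d / 2 + 1 := by lia
        have e2 : (h + 2 + d - (h + 2)) / 2 = d / 2 := by lia
        have e3 : (h + 2 + d + 1 - (h + 1)) / 2 = d / 2 + 1 := by lia
        rw [if_pos (by lia), if_pos (by lia), if_pos (by lia), e1, e2, e3,
          Nat.choose_succ_succ (h + 2 + d) (d / 2)]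
        ring
      · by_cases h2 : h ≤ n
        · have e1 : (n - h) / 2 = 0 := by lia
          have e2 : (n + 1 - (h + 1)) / 2 = 0 := by lia
          rw [if_pos h2, if_neg h1, if_pos (by lia), e1, e2]
          simp
        · rw [if_neg h2, if_neg h1, if_neg (by lia)]

/-- Decomposition of a path at its first visit to height `0`. -/
theorem pathCount_false_eq_sum (n h : ℕ) :
    pathCount false n h =
      ∑ p ∈ Finset.HasAntidiagonal.antidiagonal n, pathCount true p.1 h * pathCount false p.2 0 := by
  induction n generalizing h with
  | zero => rcases h with _ | h <;> simp [pathCount]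
  | succ n ih =>
    rw [Finset.Nat.sum_antidiagonal_succ]
    rcases h with _ | _ | h
    · simp [pathCount]
    · simp only [zero_add, pathCount, add_mul, Finset.sum_add_distrib, zero_mul]
      rw [ih 0, ih 1, ih 2]
    · simp only [zero_add, pathCount, add_mul, Finset.sum_add_distrib, zero_mul]
      rw [ih (h + 1), ih (h + 3)]

/-! ### Words encoding the paths -/

/-- The height before step `k` of the path with initial height `h` and steps `w`. -/
def height (h : ℤ) {n : ℕ} (w : Fin n → SignType) (k : ℕ) : ℤ :=
  h + ∑ j : Fin n, if (j : ℕ) < k then (w j : ℤ) else 0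

/-- The step `a` may be taken at height `h`. -/
def StepOk (s : Bool) (h : ℤ) (a : SignType) : Prop :=
  0 ≤ h ∧ (s = true → 0 < h) ∧ (a = -1 → 0 < h) ∧ (a = 0 → h ≤ 1)

/-- The word `w` encodes one of the paths counted by `pathCount`. -/
def IsPath (s : Bool) (h : ℤ) {n : ℕ} (w : Fin n → SignType) : Prop :=
  h + ∑ j, (w j : ℤ) = 0 ∧ ∀ i : Fin n, StepOk s (height h w i) (w i)

theorem height_zero (h : ℤ) {n : ℕ} (w : Fin n → SignType) : height h w 0 = h := by
  simp [height]

theorem height_cons_succ (h : ℤ) {n : ℕ} (a : SignType) (w : Fin n → SignType) (k : ℕ) :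
    height h (Fin.cons a w : Fin (n + 1) → SignType) (k + 1) = height (h + a) w k := by
  simp [height, Fin.sum_univ_succ, add_assoc]

theorem isPath_cons (s : Bool) (h : ℤ) {n : ℕ} (a : SignType) (w : Fin n → SignType) :
    IsPath s h (Fin.cons a w : Fin (n + 1) → SignType) ↔ StepOk s h a ∧ IsPath s (h + a) w := by
  unfold IsPath
  rw [Fin.forall_fin_succ]
  simp only [Fin.sum_univ_succ, Fin.cons_zero, Fin.cons_succ, Fin.val_zero, height_zero,
    Fin.val_succ, height_cons_succ, add_assoc]
  tauto

theorem natCard_isPath_succ (s : Bool) (h : ℤ) (n : ℕ) [∀ a, Decidable (StepOk s h a)] :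
    Nat.card {w : Fin (n + 1) → SignType // IsPath s h w} =
      ∑ a : SignType, if StepOk s h a then
        Nat.card {w : Fin n → SignType // IsPath s (h + a) w} else 0 := by
  classical
  have key : ∀ (m : ℕ) (p : (Fin m → SignType) → Prop),
      Nat.card {w // p w} = ∑ w, if p w then 1 else 0 := by
    intro m p
    rw [Nat.card_eq_fintype_card, Fintype.card_subtype, Finset.card_filter]
  rw [key, ← (Fin.consEquiv fun _ : Fin (n + 1) => SignType).sum_comp, Fintype.sum_prod_type]
  refine Finset.sum_congr rfl fun a _ => ?_
  rw [key]
  split_ifs with ha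
  · refine Finset.sum_congr rfl fun w _ => ?_
    simp [Fin.consEquiv, isPath_cons, ha]
  · refine Finset.sum_eq_zero fun w _ => ?_
    simp [Fin.consEquiv, isPath_cons, ha]

theorem natCard_isPath (s : Bool) (n h : ℕ) :
    Nat.card {w : Fin n → SignType // IsPath s h w} = pathCount s n h := by
  classical
  have huniv : (Finset.univ : Finset SignType) = {0, -1, 1} := by decide
  induction n generalizing h with
  | zero =>
    rcases h with _ | h
    · have : ∀ w : Fin 0 → SignType, IsPath s (0 : ℕ) w := fun w => by simp [IsPath]
      rw [Nat.card_congr (Equiv.subtypeUnivEquiv this)]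
      simp [pathCount]
    · have : ∀ w : Fin 0 → SignType, ¬ IsPath s (h + 1 : ℕ) w := fun w => by
        simp only [IsPath, Finset.univ_eq_empty, Finset.sum_empty]
        lia
      have : IsEmpty {w : Fin 0 → SignType // IsPath s (h + 1 : ℕ) w} := ⟨fun w => this _ w.2⟩
      rw [Nat.card_of_isEmpty, pathCount]
  | succ n ih =>
    rw [natCard_isPath_succ, huniv, Finset.sum_insert (by decide), Finset.sum_insert (by decide),
      Finset.sum_singleton]
    have hu : ((h : ℤ) + ((1 : SignType) : ℤ)) = (h + 1 : ℕ) := by simp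
    have hf : ((h : ℤ) + ((0 : SignType) : ℤ)) = (h : ℕ) := by simp
    rw [hu, hf, ih, ih]
    rcases h with _ | _ | h
    · cases s <;> simp [StepOk, pathCount]
    · have hd : (((0 + 1 : ℕ) : ℤ) + ((-1 : SignType) : ℤ)) = (0 : ℕ) := by simp
      rw [hd, ih]
      simp [StepOk, pathCount]
      ring
    · have hd : (((h + 1 + 1 : ℕ) : ℤ) + ((-1 : SignType) : ℤ)) = (h + 1 : ℕ) := by simp
      rw [hd, ih]
      have h1 : StepOk s (h + 1 + 1 : ℕ) (-1) := ⟨by lia, by lia, by lia, by simp⟩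
      have h2 : StepOk s (h + 1 + 1 : ℕ) 1 := ⟨by lia, by lia, by lia, by simp⟩
      have h3 : ¬ StepOk s (h + 1 + 1 : ℕ) 0 := fun H => by
        have := H.2.2.2 rfl
        lia
      rw [if_neg h3, if_pos h1, if_pos h2, zero_add, pathCount]

/-- A word that describes a path from `0` to `0` staying positive in between. -/
theorem isPath_and_pos_cons_iff {n : ℕ} (a : SignType) (w : Fin (n + 1) → SignType) :
    (IsPath false 0 (Fin.cons a w : Fin (n + 2) → SignType) ∧
      ∀ i : Fin (n + 2), i ≠ 0 → 0 < height 0 (Fin.cons a w : Fin (n + 2) → SignType) i) ↔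
    a = 1 ∧ IsPath true 1 w := by
  rw [isPath_cons, Fin.forall_fin_succ]
  simp only [Fin.val_succ, height_cons_succ, ne_eq, not_true_eq_false, false_imp_iff, true_and,
    Fin.succ_ne_zero, not_false_eq_true, true_imp_iff, zero_add]
  constructor
  · rintro ⟨⟨-, h1, h2⟩, h3⟩
    have h4 : (0 : ℤ) < a := by simpa [height_zero] using h3 0
    have ha : a = 1 := by
      rcases a.trichotomy with rfl | rfl | rfl <;> simp_all
    subst ha
    refine ⟨rfl, h1, fun i => ⟨(h2 i).1, fun _ => h3 i, (h2 i).2.2⟩⟩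
  · rintro ⟨rfl, h1, h2⟩
    refine ⟨⟨⟨le_rfl, by simp, by simp, by simp⟩, h1, fun i => ⟨(h2 i).1, by simp, (h2 i).2.2⟩⟩,
      fun i => (h2 i).2.1 rfl⟩

theorem natCard_isPath_and_pos (n : ℕ) :
    Nat.card {w : Fin (n + 2) → SignType //
      IsPath false 0 w ∧ ∀ i : Fin (n + 2), i ≠ 0 → 0 < height 0 w i} = n.choose (n / 2) := by
  have e : {w : Fin (n + 1) → SignType // IsPath true (1 : ℕ) w} ≃
      {w : Fin (n + 2) → SignType //
        IsPath false 0 w ∧ ∀ i : Fin (n + 2), i ≠ 0 → 0 < height 0 w i} :=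
    { toFun := fun w => ⟨Fin.cons 1 w.1, (isPath_and_pos_cons_iff 1 w.1).2 ⟨rfl, by
        exact_mod_cast w.2⟩⟩
      invFun := fun w => ⟨Fin.tail w.1, by
        have := w.2
        rw [← Fin.cons_self_tail w.1] at this
        exact_mod_cast ((isPath_and_pos_cons_iff _ _).1 this).2⟩
      left_inv := fun w => by simp
      right_inv := fun w => by
        have := w.2
        rw [← Fin.cons_self_tail w.1] at this
        have h1 := ((isPath_and_pos_cons_iff _ _).1 this).1
        apply Subtype.ext
        simp only
        rw [← h1]
        exact Fin.cons_self_tail w.1 }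
  rw [← Nat.card_congr e, natCard_isPath, pathCount_true_succ_succ n 0]
  simp

/-! ### Generating functions -/

open PowerSeries in
/-- The generating function of the central entries of Pascal's triangle. -/
noncomputable def centralSeries : PowerSeries ℚ :=
  PowerSeries.mk fun n => (n.choose (n / 2) : ℚ)

open PowerSeries in
/-- The generating function of the paths from `0` to `0`. -/
noncomputable def pathSeries : PowerSeries ℚ :=
  PowerSeries.mk fun n => (pathCount false n 0 : ℚ)

-- A path is empty, or starts flat at 0, or starts upward; in the last case it is cut where it first
-- comes back to 0, and first passages from 1 have series `X * centralSeries`.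
open PowerSeries in
theorem pathSeries_eq :
    pathSeries = 1 + X * pathSeries + X * (X * centralSeries * pathSeries) := by
  have h1 : (PowerSeries.mk fun n => (pathCount false n 1 : ℚ)) =
      X * centralSeries * pathSeries := by
    have hX : X * centralSeries = PowerSeries.mk fun n => (pathCount true n 1 : ℚ) := by
      ext n
      rcases n with _ | n
      · simp [pathCount]
      · rw [coeff_succ_X_mul, coeff_mk, pathCount_true_succ_succ n 0]
        simp [centralSeries]
    rw [hX]
    ext n
    rw [coeff_mul, coeff_mk, pathCount_false_eq_sum]
    simp [pathSeries]
  rw [← h1]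
  ext n
  rcases n with _ | n
  · simp [pathSeries, pathCount]
  · rw [map_add, map_add, coeff_succ_X_mul, coeff_succ_X_mul, coeff_one]
    simp [pathSeries, pathCount]

open PowerSeries in
/-- The square root of `1 - 4 x ^ 2`. -/
noncomputable def sqrtSeries : PowerSeries ℚ :=
  (1 - 2 * X) * (1 + 2 * X * centralSeries)

-- With `C` the Catalan series and `Q = C(x²)`, the classical root is `√(1 - 4x²) = 1 - 2x²Q`. The
-- product defining `sqrtSeries` agrees with it because `(1 - 2x)B = 1 - xQ`.
open PowerSeries in
theorem exists_catalan_sqrtSeries :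
    ∃ Q : PowerSeries ℚ, Q = 1 + X ^ 2 * Q ^ 2 ∧ sqrtSeries = 1 - 2 * X ^ 2 * Q := by
  let Q₀ : PowerSeries ℚ := PowerSeries.map (Nat.castRingHom ℚ) catalanSeries
  have hQ₀ : Q₀ ^ 2 * X + 1 = Q₀ := by
    have := congrArg (PowerSeries.map (Nat.castRingHom ℚ)) catalanSeries_sq_mul_X_add_one
    simpa [Q₀] using this
  let Q : PowerSeries ℚ := expand 2 two_ne_zero Q₀
  have hQ : Q ^ 2 * X ^ 2 + 1 = Q := by
    have := congrArg (expand 2 two_ne_zero) hQ₀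
    simpa [Q] using this
  have hcoeff : ∀ n, coeff n Q = if 2 ∣ n then (catalan (n / 2) : ℚ) else 0 := by
    intro n
    simp [Q, Q₀, coeff_expand]
  -- Coefficientwise: `C(2k+1, k) = 2 C(2k, k) - Cat k` and `C(2k+2, k+1) = 2 C(2k+1, k)`.
  have hB : centralSeries = 1 + X * (2 * centralSeries - Q) := by
    ext n
    rcases n with _ | n
    · simp [centralSeries]
    · have h2 : (2 : PowerSeries ℚ) = C 2 := (map_ofNat C 2).symm
      rw [map_add, coeff_succ_X_mul, coeff_one, map_sub, hcoeff, h2, coeff_C_mul]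
      simp only [centralSeries, coeff_mk, Nat.succ_ne_zero, if_false, zero_add]
      rcases Nat.even_or_odd' n with ⟨k, rfl | rfl⟩
      · have e1 : (2 * k + 1) / 2 = k := by lia
        have e2 : 2 * k / 2 = k := by lia
        rw [e1, e2, if_pos (by lia)]
        have h3 := succ_mul_catalan_eq_centralBinom k
        rw [Nat.centralBinom_eq_two_mul_choose] at h3
        have h4 := Nat.add_one_mul_choose_eq (2 * k) k
        have h5 : (2 * k + 1).choose (k + 1) = (2 * k + 1).choose k := Nat.choose_symm_half k
        simp only [h5] at h4
        have h3' : ((k : ℚ) + 1) * catalan k = (2 * k).choose k := by exact_mod_cast h3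
        have h4' : (2 * (k : ℚ) + 1) * (2 * k).choose k = (2 * k + 1).choose k * (k + 1) := by
          exact_mod_cast h4
        have hk : (k : ℚ) + 1 ≠ 0 := by positivity
        apply mul_left_cancel₀ hk
        linear_combination -h4' + h3'
      · have e1 : (2 * k + 1 + 1) / 2 = k + 1 := by lia
        have e2 : (2 * k + 1) / 2 = k := by lia
        rw [e1, e2, if_neg (by lia), Nat.choose_succ_succ, Nat.succ_eq_add_one,
          Nat.choose_symm_half k]
        push_cast
        ring
  refine ⟨Q, by linear_combination -hQ, ?_⟩
  unfold sqrtSeries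
  linear_combination (2 * X) * hB

open PowerSeries in
theorem sqrtSeries_sq : sqrtSeries ^ 2 = 1 - 4 * X ^ 2 := by
  obtain ⟨Q, h1, h2⟩ := exists_catalan_sqrtSeries
  rw [h2]
  linear_combination (-4 * X ^ 2) * h1

open PowerSeries in
theorem constantCoeff_sqrtSeries : constantCoeff sqrtSeries = 1 := by
  simp [sqrtSeries]

open PowerSeries in
theorem pathSeries_sub_one_mul :
    (pathSeries - 1) * (2 * X * (1 - X) - 1 + sqrtSeries) = 2 * X ^ 2 := by
  have hP := pathSeries_eq
  -- This is `sqrtSeries_sq` after cancelling `4x(1 - 2x)`.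
  have hB : (1 - 2 * X) * (centralSeries + X * centralSeries ^ 2) = 1 := by
    have h := sqrtSeries_sq
    have h0 : (1 - 2 * X : PowerSeries ℚ) ≠ 0 := fun H => by
      have := congrArg constantCoeff H
      simp at this
    have hX : (4 * X : PowerSeries ℚ) ≠ 0 := by
      refine mul_ne_zero ?_ X_ne_zero
      intro H
      have := congrArg constantCoeff H
      rw [← map_ofNat C 4, constantCoeff_C] at this
      norm_num at this
    apply mul_left_cancel₀ (mul_ne_zero hX h0)
    unfold sqrtSeries at h
    linear_combination h
  have hU : (1 - X - X ^ 2 * centralSeries : PowerSeries ℚ) ≠ 0 := fun H => by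
    have := congrArg constantCoeff H
    simp at this
  apply mul_left_cancel₀ hU
  unfold sqrtSeries
  linear_combination (2 * X ^ 2) * hB +
    (2 * X * (1 - X) - 1 + (1 - 2 * X) * (1 + 2 * X * centralSeries)) * hP


variable {n : ℕ}

/-! ### Avoiding `321` -/

theorem avoids_pattern321_iff (π : Perm (Fin n)) :
    Avoids π pattern321 ↔ ∀ i j k, i < j → j < k → π k < π j → π j < π i → False := by
  constructor
  · intro h i j k hij hjk hkj hji
    refine h ⟨OrderEmbedding.ofStrictMono ![i, j, k] ?_, ?_⟩
    · intro a b hab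
      have hik := hij.trans hjk
      fin_cases a <;> fin_cases b <;> simp_all
    · have hki := hkj.trans hji
      intro r s
      change π (![i, j, k] r) < π (![i, j, k] s) ↔ Fin.rev r < Fin.rev s
      rw [Fin.rev_lt_rev]
      fin_cases r <;> fin_cases s <;> simp [hkj, hji, hki, hkj.le, hji.le, hki.le]
  · rintro h ⟨f, hf⟩
    refine h (f 0) (f 1) (f 2) (f.strictMono (by decide)) (f.strictMono (by decide)) ?_ ?_
    · rw [hf]; decide
    · rw [hf]; decide

/-! ### The standard cycle word is sorted -/

/-- The largest element of the cycle of `π` through `x`. -/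
def cycleMax (π : Perm (Fin n)) (x : Fin n) : Fin n :=
  (Finset.univ.filter fun j => π.SameCycle x j).max' ⟨x, by simp [Perm.SameCycle.refl]⟩

theorem sameCycle_cycleMax (π : Perm (Fin n)) (x : Fin n) : π.SameCycle x (cycleMax π x) := by
  have := Finset.max'_mem (Finset.univ.filter fun j => π.SameCycle x j)
    ⟨x, by simp [Perm.SameCycle.refl]⟩
  exact (Finset.mem_filter.1 this).2

theorem le_cycleMax {π : Perm (Fin n)} {x y : Fin n} (h : π.SameCycle x y) :
    y ≤ cycleMax π x :=
  Finset.le_max' _ _ (by simpa using h)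

theorem cycleMax_eq_of_sameCycle {π : Perm (Fin n)} {x y : Fin n} (h : π.SameCycle x y) :
    cycleMax π x = cycleMax π y :=
  le_antisymm (le_cycleMax (h.symm.trans (sameCycle_cycleMax π x)))
    (le_cycleMax (h.trans (sameCycle_cycleMax π y)))

theorem cycleMax_apply (π : Perm (Fin n)) (x : Fin n) : cycleMax π (π x) = cycleMax π x :=
  cycleMax_eq_of_sameCycle (Perm.sameCycle_apply_left.2 (Perm.SameCycle.refl π x))

theorem cycleMax_cycleMax (π : Perm (Fin n)) (x : Fin n) :
    cycleMax π (cycleMax π x) = cycleMax π x :=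
  (cycleMax_eq_of_sameCycle (sameCycle_cycleMax π x)).symm

theorem cycleMax_eq_self_of_isCycleMax {π : Perm (Fin n)} {m : Fin n} (h : IsCycleMax π m) :
    cycleMax π m = m :=
  le_antisymm (h _ (sameCycle_cycleMax π m)) (le_cycleMax (Perm.SameCycle.refl π m))

theorem exists_pow_cycleMax (π : Perm (Fin n)) (x : Fin n) :
    ∃ a : ℕ, (π ^ a) (cycleMax π x) = x := by
  obtain ⟨a, -, -, h⟩ := (sameCycle_cycleMax π x).symm.exists_pow_eq''
  exact ⟨a, h⟩

/-- The distance from the largest element of its cycle to `x`. -/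
def cycleIndex (π : Perm (Fin n)) (x : Fin n) : ℕ :=
  Nat.find (exists_pow_cycleMax π x)

theorem pow_cycleIndex (π : Perm (Fin n)) (x : Fin n) :
    (π ^ cycleIndex π x) (cycleMax π x) = x :=
  Nat.find_spec (exists_pow_cycleMax π x)

theorem cycleIndex_eq_zero {π : Perm (Fin n)} {x : Fin n} (h : cycleMax π x = x) :
    cycleIndex π x = 0 := by
  rw [cycleIndex, Nat.find_eq_zero]
  simpa using h

theorem cycleIndex_pos {π : Perm (Fin n)} {x : Fin n} (h : cycleMax π x ≠ x) :
    0 < cycleIndex π x := by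
  rw [cycleIndex, Nat.find_pos]
  simpa using h

/-- No step before the `cycleIndex` brings us back to the maximum. -/
theorem cycleIndex_pow {π : Perm (Fin n)} {m : Fin n} (hm : cycleMax π m = m) {a : ℕ}
    (h : ∀ c, 0 < c → c ≤ a → (π ^ c) m ≠ m) : cycleIndex π ((π ^ a) m) = a := by
  have hM : cycleMax π ((π ^ a) m) = m := by
    rw [← cycleMax_eq_of_sameCycle (Perm.sameCycle_pow_right.2 (Perm.SameCycle.refl π m)), hm]
  rw [cycleIndex, Nat.find_eq_iff, hM]
  refine ⟨rfl, fun b hb heq => h (a - b) (by lia) (by lia) ?_⟩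
  have : (π ^ a) m = (π ^ b) ((π ^ (a - b)) m) := by
    rw [← Perm.mul_apply, ← pow_add, Nat.add_sub_cancel' hb.le]
  rw [this] at heq
  exact ((π ^ b).injective heq).symm

/-- A return to the maximum after `c` steps would let `x` be reached `c` steps sooner, against
minimality. -/
theorem pow_ne_of_le_cycleIndex {π : Perm (Fin n)} {x : Fin n} {c : ℕ} (h0 : 0 < c)
    (hc : c ≤ cycleIndex π x) : (π ^ c) (cycleMax π x) ≠ cycleMax π x := by
  intro h
  refine Nat.find_min (exists_pow_cycleMax π x) (m := cycleIndex π x - c)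
    (Nat.sub_lt (h0.trans_le hc) h0) ?_
  conv_rhs => rw [← pow_cycleIndex π x, ← Nat.sub_add_cancel hc, pow_add, Perm.mul_apply, h]

theorem cycleIndex_apply {π : Perm (Fin n)} {x : Fin n} (h : π x ≠ cycleMax π x) :
    cycleIndex π (π x) = cycleIndex π x + 1 := by
  have hx : (π ^ (cycleIndex π x + 1)) (cycleMax π x) = π x := by
    rw [pow_succ', Perm.mul_apply, pow_cycleIndex]
  conv_lhs => rw [← hx]
  refine cycleIndex_pow (cycleMax_cycleMax π x) fun c h0 hc => ?_
  rcases hc.lt_or_eq with hc | rfl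
  · exact pow_ne_of_le_cycleIndex h0 (Nat.lt_succ_iff.1 hc)
  · rwa [hx]

/-- The sorting key of the standard cycle word. -/
def cycleKey (π : Perm (Fin n)) (x : Fin n) : Fin n ×ₗ ℕ :=
  toLex (cycleMax π x, cycleIndex π x)

theorem cycleKey_lt_iff {π : Perm (Fin n)} {x y : Fin n} :
    cycleKey π x < cycleKey π y ↔ cycleMax π x < cycleMax π y ∨
      cycleMax π x = cycleMax π y ∧ cycleIndex π x < cycleIndex π y := by
  simp [cycleKey, Prod.Lex.lt_iff]

theorem cycleKey_injective (π : Perm (Fin n)) : Function.Injective (cycleKey π) := by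
  intro x y h
  have h1 : cycleMax π x = cycleMax π y := congrArg (fun p => (ofLex p).1) h
  have h2 : cycleIndex π x = cycleIndex π y := congrArg (fun p => (ofLex p).2) h
  rw [← pow_cycleIndex π x, ← pow_cycleIndex π y, h1, h2]

theorem pairwise_cycleFrom {π : Perm (Fin n)} {m : Fin n} (hm : cycleMax π m = m) :
    (cycleFrom π m).Pairwise fun x y => cycleKey π x < cycleKey π y := by
  unfold cycleFrom
  split_ifs with h
  · exact List.pairwise_singleton _ _
  · have hidx : ∀ i (hi : i < (π.toList m).length), cycleIndex π (π.toList m)[i] = i := by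
      intro i hi
      rw [Perm.getElem_toList]
      refine cycleIndex_pow hm fun c h0 hc hcm => ?_
      have h1 : (π.toList m)[c]'(hc.trans_lt hi) = (π.toList m)[0]'(by lia) := by
        rw [Perm.getElem_toList, Perm.getElem_toList, hcm]
        rfl
      have := (List.Nodup.getElem_inj_iff (Perm.nodup_toList π m)).1 h1
      lia
    have hmax : ∀ i (hi : i < (π.toList m).length), cycleMax π (π.toList m)[i] = m := by
      intro i hi
      rw [Perm.getElem_toList,
        ← cycleMax_eq_of_sameCycle (Perm.sameCycle_pow_right.2 (Perm.SameCycle.refl π m)), hm]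
    rw [List.pairwise_iff_getElem]
    intro i j hi hj hij
    rw [cycleKey_lt_iff, hmax, hmax, hidx, hidx]
    exact Or.inr ⟨rfl, hij⟩

theorem pairwise_standardCycleWord (π : Perm (Fin n)) :
    (standardCycleWord π).Pairwise fun x y => cycleKey π x < cycleKey π y := by
  unfold standardCycleWord
  rw [List.pairwise_flatMap]
  have hmax : ∀ m ∈ (List.finRange n).filter (fun m => IsCycleMax π m), cycleMax π m = m :=
    fun m hm => cycleMax_eq_self_of_isCycleMax (by simpa using (List.mem_filter.1 hm).2)
  refine ⟨fun m hm => pairwise_cycleFrom (hmax m hm), ?_⟩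
  refine List.Pairwise.imp_of_mem ?_ ((List.pairwise_lt_finRange n).filter _)
  intro a b ha hb hab x hx y hy
  rw [mem_cycleFrom] at hx hy
  rw [cycleKey_lt_iff, ← cycleMax_eq_of_sameCycle hx, ← cycleMax_eq_of_sameCycle hy, hmax a ha,
    hmax b hb]
  exact Or.inl hab

theorem strictMono_cycleKey_theta (π : Perm (Fin n)) :
    StrictMono fun i => cycleKey π (theta π i) := by
  have h := pairwise_standardCycleWord π
  rw [← ofFn_theta, List.pairwise_ofFn] at h
  exact fun i j hij => h hij

/-- Since `theta π` lists the letters by increasing `cycleKey`, comparing positions in the word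
means comparing keys, and `theta` itself can be forgotten from here on. -/
theorem avoids_theta_iff (π : Perm (Fin n)) :
    Avoids (theta π) pattern321 ↔ ∀ x y z, cycleKey π x < cycleKey π y →
      cycleKey π y < cycleKey π z → z < y → y < x → False := by
  have hlt : ∀ i j, i < j ↔ cycleKey π (theta π i) < cycleKey π (theta π j) := fun i j =>
    ((strictMono_cycleKey_theta π).lt_iff_lt (a := i) (b := j)).symm
  rw [avoids_pattern321_iff]
  constructor
  · intro h x y z hxy hyz
    exact fun hzy hyx => h ((theta π).symm x) ((theta π).symm y) ((theta π).symm z)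
      ((hlt _ _).2 (by simpa using hxy)) ((hlt _ _).2 (by simpa using hyz)) (by simpa using hzy)
      (by simpa using hyx)
  · intro h i j k hij hjk
    exact h _ _ _ ((hlt i j).1 hij) ((hlt j k).1 hjk)

theorem cycleKey_cycleMax_lt {π : Perm (Fin n)} {x : Fin n} (h : cycleMax π x ≠ x) :
    cycleKey π (cycleMax π x) < cycleKey π x := by
  rw [cycleKey_lt_iff, cycleMax_cycleMax, cycleIndex_eq_zero (cycleMax_cycleMax π x)]
  exact Or.inr ⟨rfl, cycleIndex_pos h⟩

theorem cycleKey_lt_apply {π : Perm (Fin n)} {x : Fin n} (h : π x ≠ cycleMax π x) :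
    cycleKey π x < cycleKey π (π x) := by
  rw [cycleKey_lt_iff, cycleMax_apply, cycleIndex_apply h]
  exact Or.inr ⟨rfl, Nat.lt_succ_self _⟩

/-- Within a cycle, `x` and `π x` are adjacent in the standard cycle word. -/
theorem lt_or_apply_lt_of_cycleKey {π : Perm (Fin n)} {x y : Fin n} (h : π x ≠ cycleMax π x)
    (h1 : y ≠ x) (h2 : y ≠ π x) :
    cycleKey π y < cycleKey π x ∨ cycleKey π (π x) < cycleKey π y := by
  rcases lt_trichotomy (cycleKey π y) (cycleKey π x) with h3 | h3 | h3
  · exact Or.inl h3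
  · exact absurd (cycleKey_injective π h3) h1
  rcases lt_trichotomy (cycleKey π (π x)) (cycleKey π y) with h4 | h4 | h4
  · exact Or.inr h4
  · exact absurd (cycleKey_injective π h4).symm h2
  rw [cycleKey_lt_iff] at h3 h4
  rw [cycleMax_apply, cycleIndex_apply h] at h4
  lia


/-! ### Crossing numbers and monotonicity -/

theorem card_filter_apply (π : Perm (Fin n)) (p : Fin n → Prop) [DecidablePred p] :
    (Finset.univ.filter fun x => p (π x)).card = (Finset.univ.filter p).card := by
  refine Finset.card_bij (fun x _ => π x) (by simp) (fun x _ y _ h => π.injective h) fun y hy => ?_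
  exact ⟨π.symm y, by simpa using hy, by simp⟩

/-- As many letters move up across `k` as move down. -/
theorem card_crossing (π : Perm (Fin n)) (k : ℕ) :
    (Finset.univ.filter fun x : Fin n => (x : ℕ) < k ∧ k ≤ π x).card =
      (Finset.univ.filter fun x : Fin n => ((π x : Fin n) : ℕ) < k ∧ k ≤ x).card := by
  have h1 := card_filter_apply π fun x : Fin n => (x : ℕ) < k
  have h2 := Finset.card_filter_add_card_filter_not (s := Finset.univ.filter fun x : Fin n =>
    ((π x : Fin n) : ℕ) < k) (fun x => (x : ℕ) < k)
  have h3 := Finset.card_filter_add_card_filter_not (s := Finset.univ.filter fun x : Fin n =>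
    (x : ℕ) < k) (fun x => ((π x : Fin n) : ℕ) < k)
  simp only [Finset.filter_filter, not_lt] at h2 h3
  have h4 : (Finset.univ.filter fun x : Fin n => ((π x : Fin n) : ℕ) < k ∧ (x : ℕ) < k) =
      Finset.univ.filter fun x : Fin n => (x : ℕ) < k ∧ ((π x : Fin n) : ℕ) < k := by
    simp only [and_comm]
  rw [h4] at h2
  lia

theorem exists_crossing_iff (π : Perm (Fin n)) (k : ℕ) :
    (∃ x : Fin n, (x : ℕ) < k ∧ k ≤ π x) ↔ ∃ x : Fin n, ((π x : Fin n) : ℕ) < k ∧ k ≤ x := by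
  have h := card_crossing π k
  have h1 : (Finset.univ.filter fun x : Fin n => (x : ℕ) < k ∧ k ≤ π x).Nonempty ↔
      (Finset.univ.filter fun x : Fin n => ((π x : Fin n) : ℕ) < k ∧ k ≤ x).Nonempty := by
    rw [← Finset.card_pos, ← Finset.card_pos, h]
  simpa [Finset.Nonempty] using h1

/-- The absence of the pattern `321`, in terms of positions. -/
def NoDecreasing (π : Perm (Fin n)) : Prop :=
  ∀ i j k, i < j → j < k → π k < π j → π j < π i → False

/-- `x` moves down across its own position, so some `z < x` moves up to `x` or beyond; an inversion
at `x, y` would complete `z, x, y` to a 321. -/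
theorem NoDecreasing.lt_of_lt_of_apply_lt {π : Perm (Fin n)} (h : NoDecreasing π) {x y : Fin n}
    (hxy : x < y) (hx : π x < x) : π x < π y := by
  by_contra hc
  have hc' : π y < π x := lt_of_le_of_ne (not_lt.1 hc) fun he => hxy.ne' (π.injective he)
  obtain ⟨z, hz1, hz2⟩ := (exists_crossing_iff π x).2 ⟨x, hx, le_rfl⟩
  exact h z x y hz1 hxy hc' (hx.trans_le hz2)

/-- Mirror image: an inversion makes `x` cross the gap just above `y`, hence the cut at `y + 1`, and
a letter coming back down across it completes a 321. -/
theorem NoDecreasing.lt_of_lt_of_le_apply {π : Perm (Fin n)} (h : NoDecreasing π) {x y : Fin n}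
    (hxy : x < y) (hy : y ≤ π y) : π x < π y := by
  by_contra hc
  have hc' : π y < π x := lt_of_le_of_ne (not_lt.1 hc) fun he => hxy.ne' (π.injective he)
  obtain ⟨z, hz1, hz2⟩ := (exists_crossing_iff π (y + 1)).1
    ⟨x, by lia, by have := hy.trans_lt hc'; lia⟩
  have hzy : y < z := by lia
  have : π z < π y := lt_of_le_of_ne (le_trans (by lia) hy) fun he => hzy.ne' (π.injective he)
  exact h x y z hxy hzy this hc'

/-! ### A criterion in terms of the letters of `π` -/

/-- The condition on a `321`-avoiding `π` under which `theta π` avoids `321`: along a cycle no two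
consecutive descents occur, and a letter strictly between `x` and a larger `π x` is larger than
its image or smaller than its preimage. -/
def IsTame (π : Perm (Fin n)) : Prop :=
  (∀ j, π j < j → ¬ j < π.symm j) ∧ ∀ x z, x < z → z < π x → π z < z ∨ z < π.symm z

/-- Each violation yields a 321 in the word headed by a cycle maximum: the maximum followed by `j, π
j` in the first case; in the second, `x` is compared with the adjacent letters `π⁻¹ z, z`. -/
theorem isTame_of_avoids_theta {π : Perm (Fin n)} (h : NoDecreasing π)
    (hθ : Avoids (theta π) pattern321) : IsTame π := by
  rw [avoids_theta_iff] at hθ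
  constructor
  · intro j hj hj'
    have hm : j < cycleMax π j := hj'.trans_le
      (le_cycleMax (Perm.sameCycle_symm_apply_right.2 (Perm.SameCycle.refl π j)))
    exact hθ _ _ _ (cycleKey_cycleMax_lt hm.ne') (cycleKey_lt_apply (hj.trans hm).ne) hj hm
  · intro x z hxz hzx
    by_contra! hc
    obtain ⟨hz1, hz2⟩ := hc
    set p := π.symm z with hp
    have hpz : π p = z := by simp [hp]
    have hpx : p < x := by
      by_contra hxp
      have hne : x ≠ p := by
        rintro rfl
        exact absurd hzx (by simp [hp])
      have := h.lt_of_lt_of_le_apply (lt_of_le_of_ne (not_lt.1 hxp) hne) (by rw [hpz]; exact hz2)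
      rw [hpz] at this
      exact absurd (this.trans hzx) (lt_irrefl _)
    have hzz : π x < π z := h.lt_of_lt_of_le_apply hxz hz1
    have hzm : z < cycleMax π z := (hzx.trans hzz).trans_le
      (le_cycleMax (Perm.sameCycle_apply_right.2 (Perm.SameCycle.refl π z)))
    have hxm : x < cycleMax π x := (hxz.trans hzx).trans_le
      (le_cycleMax (Perm.sameCycle_apply_right.2 (Perm.SameCycle.refl π x)))
    have hpm : π p ≠ cycleMax π p := by
      rw [← cycleMax_apply, hpz]
      exact hzm.ne
    -- No letter fits between `p` and `z`. If `x` precedes `p`, the 321 is `cycleMax π x, x, p`;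
    -- otherwise it is `cycleMax π z, z, x`.
    rcases lt_or_apply_lt_of_cycleKey (y := x) hpm hpx.ne' (hpz ▸ hxz.ne) with h1 | h1
    · exact hθ _ _ _ (cycleKey_cycleMax_lt hxm.ne') h1 hpx hxm
    · rw [hpz] at h1
      exact hθ _ _ _ (cycleKey_cycleMax_lt hzm.ne') h1 hxz hzm

/-- The number of letters `j ≤ x` that are images of larger letters. -/
def upRank (π : Perm (Fin n)) (x : Fin n) : ℕ :=
  (Finset.univ.filter fun j => j ≤ x ∧ j < π.symm j).card

/-- The number of letters `j ≤ x` with smaller images. -/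
def downRank (π : Perm (Fin n)) (x : Fin n) : ℕ :=
  (Finset.univ.filter fun j => j ≤ x ∧ π j < j).card

/-- Along the cycles of a tame permutation without `321`, this is constant. -/
def cycleRank (π : Perm (Fin n)) (x : Fin n) : ℕ :=
  if π x < x then downRank π x else upRank π x

theorem upRank_mono (π : Perm (Fin n)) : Monotone (upRank π) := by
  intro x y hxy
  exact Finset.card_le_card (Finset.monotone_filter_right _ fun j _ hj => ⟨hj.1.trans hxy, hj.2⟩)

theorem downRank_lt {π : Perm (Fin n)} {x y : Fin n} (hxy : x < y) (hy : π y < y) :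
    downRank π x < downRank π y := by
  refine Finset.card_lt_card (Finset.ssubset_iff_of_subset ?_ |>.2 ⟨y, ?_⟩)
  · exact Finset.monotone_filter_right _ fun j _ hj => ⟨hj.1.trans hxy.le, hj.2⟩
  · simp [hy, hxy]

theorem NoDecreasing.downRank_eq_upRank {π : Perm (Fin n)} (h : NoDecreasing π) {x : Fin n}
    (hx : π x < x) : downRank π x = upRank π (π x) := by
  refine Finset.card_bij (fun j _ => π j) ?_ (fun a _ b _ hab => π.injective hab) ?_
  · simp only [Finset.mem_filter, Finset.mem_univ, true_and, Equiv.symm_apply_apply]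
    rintro j ⟨hj, hj'⟩
    refine ⟨?_, hj'⟩
    rcases hj.lt_or_eq with hj | rfl
    · exact (h.lt_of_lt_of_apply_lt hj hj').le
    · exact le_rfl
  · simp only [Finset.mem_filter, Finset.mem_univ, true_and]
    rintro j ⟨hj, hj'⟩
    refine ⟨π.symm j, ⟨?_, by simpa using hj'⟩, by simp⟩
    by_contra! hc
    have := h.lt_of_lt_of_apply_lt hc hx
    rw [Equiv.apply_symm_apply] at this
    exact absurd hj (not_le.2 this)

/-- No opener `j` lies in `(x, π x]`: the arc from `j` would pass over `π x`, which is neither a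
closer nor an opener, against tameness. -/
theorem NoDecreasing.upRank_eq_of_flat {π : Perm (Fin n)} (h : NoDecreasing π) (ht : IsTame π)
    {x : Fin n} (hx : x < π x) (hy : π x < π (π x)) : upRank π x = upRank π (π x) := by
  refine le_antisymm (upRank_mono π hx.le) (Finset.card_le_card fun j => ?_)
  simp only [Finset.mem_filter, Finset.mem_univ, true_and]
  rintro ⟨hj, hj'⟩
  refine ⟨?_, hj'⟩
  by_contra! hc
  have hjne : j ≠ π x := by
    rintro rfl
    rw [Equiv.symm_apply_apply] at hj'
    exact absurd hx hj'.not_gt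
  have hjlt : j < π x := lt_of_le_of_ne hj hjne
  have hjj : j ≤ π j := not_lt.1 fun hlt => ht.1 j hlt hj'
  rcases ht.2 j (π x) hjlt (h.lt_of_lt_of_le_apply hc hjj) with h1 | h1
  · exact absurd hy h1.not_gt
  · rw [Equiv.symm_apply_apply] at h1
    exact absurd hx h1.not_gt

/-- `π` matches the non-closers up to `x` with the non-openers up to `π x`. Both sets contain the
same flat letters, as tameness forbids any under the arc from `x` to `π x`; removing them leaves
openers and closers. -/
theorem NoDecreasing.upRank_eq_downRank {π : Perm (Fin n)} (h : NoDecreasing π) (ht : IsTame π)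
    {x : Fin n} (hx : x < π x) (hy : π (π x) < π x) : upRank π x = downRank π (π x) := by
  have key : (Finset.univ.filter fun j => j ≤ x ∧ j ≤ π j).card =
      (Finset.univ.filter fun j => j ≤ π x ∧ π.symm j ≤ j).card := by
    refine Finset.card_bij (fun j _ => π j) ?_ (fun a _ b _ hab => π.injective hab) ?_
    · simp only [Finset.mem_filter, Finset.mem_univ, true_and, Equiv.symm_apply_apply]
      rintro j ⟨hj, hj'⟩
      refine ⟨?_, hj'⟩
      rcases hj.lt_or_eq with hj | rfl
      · exact (h.lt_of_lt_of_le_apply hj hx.le).le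
      · exact le_rfl
    · simp only [Finset.mem_filter, Finset.mem_univ, true_and]
      rintro j ⟨hj, hj'⟩
      refine ⟨π.symm j, ⟨?_, by simpa using hj'⟩, by simp⟩
      by_contra! hc
      have := h.lt_of_lt_of_le_apply hc (by simpa using hj')
      rw [Equiv.apply_symm_apply] at this
      exact absurd hj (not_le.2 this)
  have flat : (Finset.univ.filter fun j => j ≤ x ∧ j ≤ π j ∧ π.symm j ≤ j) =
      Finset.univ.filter fun j => j ≤ π x ∧ j ≤ π j ∧ π.symm j ≤ j := by
    ext j
    simp only [Finset.mem_filter, Finset.mem_univ, true_and]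
    refine ⟨fun hj => ⟨hj.1.trans hx.le, hj.2⟩, fun hj => ⟨?_, hj.2⟩⟩
    by_contra! hc
    have hjne : j ≠ π x := by
      rintro rfl
      exact absurd hy hj.2.1.not_gt
    rcases ht.2 x j hc (lt_of_le_of_ne hj.1 hjne) with h1 | h1
    · exact absurd h1 hj.2.1.not_gt
    · exact absurd h1 hj.2.2.not_gt
  have h1 := Finset.card_filter_add_card_filter_not
    (s := Finset.univ.filter fun j => j ≤ x ∧ j ≤ π j) (fun j => π.symm j ≤ j)
  have h2 := Finset.card_filter_add_card_filter_not
    (s := Finset.univ.filter fun j => j ≤ π x ∧ π.symm j ≤ j) (fun j => j ≤ π j)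
  simp only [Finset.filter_filter, and_assoc, not_le] at h1 h2
  have e1 : upRank π x =
      (Finset.univ.filter fun j => j ≤ x ∧ j ≤ π j ∧ j < π.symm j).card := by
    refine congrArg Finset.card (Finset.filter_congr fun j _ => ?_)
    exact ⟨fun hj => ⟨hj.1, not_lt.1 fun hlt => ht.1 j hlt hj.2, hj.2⟩, fun hj => ⟨hj.1, hj.2.2⟩⟩
  have e2 : downRank π (π x) =
      (Finset.univ.filter fun j => j ≤ π x ∧ π.symm j ≤ j ∧ π j < j).card := by
    refine congrArg Finset.card (Finset.filter_congr fun j _ => ?_)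
    exact ⟨fun hj => ⟨hj.1, not_lt.1 fun hlt => ht.1 j hj.2 hlt, hj.2⟩, fun hj => ⟨hj.1, hj.2.2⟩⟩
  have e3 : (Finset.univ.filter fun j => j ≤ π x ∧ π.symm j ≤ j ∧ j ≤ π j) =
      Finset.univ.filter fun j => j ≤ π x ∧ j ≤ π j ∧ π.symm j ≤ j :=
    Finset.filter_congr fun j _ => by tauto
  rw [e3, ← flat] at h2
  lia

theorem NoDecreasing.cycleRank_apply {π : Perm (Fin n)} (h : NoDecreasing π) (ht : IsTame π)
    (x : Fin n) : cycleRank π (π x) = cycleRank π x := by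
  unfold cycleRank
  rcases lt_trichotomy (π x) x with hx | hx | hx
  · rw [if_pos hx, h.downRank_eq_upRank hx, if_neg]
    intro hc
    exact ht.1 (π x) hc (by simpa using hx)
  · simp only [hx]
  · rw [if_neg hx.not_gt]
    split_ifs with hy
    · exact (h.upRank_eq_downRank ht hx hy).symm
    · refine (h.upRank_eq_of_flat ht hx (lt_of_le_of_ne (not_lt.1 hy) fun he => ?_)).symm
      exact hx.ne (π.injective he)

theorem NoDecreasing.cycleRank_cycleMax {π : Perm (Fin n)} (h : NoDecreasing π) (ht : IsTame π)
    (x : Fin n) : cycleRank π (cycleMax π x) = cycleRank π x := by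
  have key : ∀ (a : ℕ) (y : Fin n), cycleRank π ((π ^ a) y) = cycleRank π y := by
    intro a
    induction a with
    | zero => simp
    | succ a ih => intro y; rw [pow_succ', Perm.mul_apply, h.cycleRank_apply ht, ih]
  conv_rhs => rw [← pow_cycleIndex π x, key]

theorem apply_cycleMax_lt {π : Perm (Fin n)} {x : Fin n} (hx : cycleMax π x ≠ x) :
    π (cycleMax π x) < cycleMax π x := by
  refine lt_of_le_of_ne (le_cycleMax ((sameCycle_cycleMax π x).trans
    (Perm.sameCycle_apply_right.2 (Perm.SameCycle.refl π _)))) fun he => hx ?_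
  exact ((sameCycle_cycleMax π x).symm.eq_of_left he)

/-- Every letter but the maximum of its cycle has a larger image. -/
theorem NoDecreasing.lt_apply {π : Perm (Fin n)} (h : NoDecreasing π) (ht : IsTame π)
    {x : Fin n} (hx : cycleMax π x ≠ x) : x < π x := by
  have hm := apply_cycleMax_lt hx
  have hr := h.cycleRank_cycleMax ht x
  rcases lt_trichotomy (π x) x with h1 | h1 | h1
  -- A second closer in the cycle would share `downRank` with the maximum, but `downRank` strictly
  -- increases at closers.
  · rw [cycleRank, cycleRank, if_pos hm, if_pos h1] at hr
    have := downRank_lt (lt_of_le_of_ne (le_cycleMax (Perm.SameCycle.refl π x)) hx.symm) hm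
    lia
  · exact absurd ((sameCycle_cycleMax π x).eq_of_left h1).symm hx
  · exact h1

/-- Between cycles, `cycleRank` transfers the order of the maxima to the other letters; within a
cycle, `π` climbs until it reaches the maximum. -/
theorem NoDecreasing.lt_of_cycleKey_lt {π : Perm (Fin n)} (h : NoDecreasing π) (ht : IsTame π)
    {x y : Fin n} (hx : cycleMax π x ≠ x) (hy : cycleMax π y ≠ y)
    (hxy : cycleKey π x < cycleKey π y) : x < y := by
  rw [cycleKey_lt_iff] at hxy
  rcases hxy with hxy | ⟨hM, hI⟩
  · have h1 := downRank_lt hxy (apply_cycleMax_lt hy)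
    have h2 := h.cycleRank_cycleMax ht x
    have h3 := h.cycleRank_cycleMax ht y
    rw [cycleRank, cycleRank, if_pos (apply_cycleMax_lt hx), if_neg (h.lt_apply ht hx).not_gt] at h2
    rw [cycleRank, cycleRank, if_pos (apply_cycleMax_lt hy), if_neg (h.lt_apply ht hy).not_gt] at h3
    by_contra! hc
    have := upRank_mono π hc
    lia
  · have key : ∀ d, cycleIndex π x + d ≤ cycleIndex π y → x ≤ (π ^ d) x ∧
        (0 < d → x < (π ^ d) x) := by
      intro d
      induction d with
      | zero => simp
      | succ d ih =>
        intro hd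
        have h1 := (ih (by lia)).1
        have h2 : (π ^ d) x < π ((π ^ d) x) := by
          have hsc := Perm.sameCycle_pow_right (n := d) |>.2 (Perm.SameCycle.refl π x)
          refine h.lt_apply ht ?_
          rw [← cycleMax_eq_of_sameCycle hsc]
          conv_rhs => rw [← pow_cycleIndex π x, ← Perm.mul_apply, ← pow_add]
          rw [hM, ne_comm]
          have := cycleIndex_pos hx
          exact pow_ne_of_le_cycleIndex (by lia) (by lia)
        rw [pow_succ', Perm.mul_apply]
        exact ⟨h1.trans h2.le, fun _ => h1.trans_lt h2⟩
    obtain ⟨d, hd⟩ := Nat.exists_eq_add_of_le hI.le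
    have h1 : (π ^ d) x = y := by
      rw [add_comm] at hd
      conv_lhs => rw [← pow_cycleIndex π x, ← Perm.mul_apply, ← pow_add, ← hd, hM, pow_cycleIndex]
    have h2 := (key d (by lia)).2 (by lia)
    rwa [h1] at h2

/-- Cycle maxima are left-to-right maxima of the word, so the last two letters of a 321 would be
non-maxima, and these appear in increasing order. -/
theorem NoDecreasing.avoids_theta {π : Perm (Fin n)} (h : NoDecreasing π) (ht : IsTame π) :
    Avoids (theta π) pattern321 := by
  rw [avoids_theta_iff]
  have key : ∀ x y, cycleKey π x < cycleKey π y → y < x → cycleMax π y ≠ y := by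
    intro x y hk hyx he
    have h1 : cycleMax π x ≤ cycleMax π y := by
      rw [cycleKey_lt_iff] at hk
      rcases hk with hk | hk
      · exact hk.le
      · exact hk.1.le
    rw [he] at h1
    exact absurd ((le_cycleMax (Perm.SameCycle.refl π x)).trans h1) (not_le.2 hyx)
  intro x y z hxy hyz hzy hyx
  exact absurd (h.lt_of_cycleKey_lt ht (key x y hxy hyx) (key y z hyz hzy) hyz) hzy.not_gt

theorem mem_avoidingSet_iff {π : Perm (Fin n)} :
    π ∈ avoidingSet n pattern321 ↔ NoDecreasing π ∧ IsTame π := by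
  change (Avoids π pattern321 ∧ _) ↔ _
  rw [avoids_pattern321_iff]
  exact ⟨fun h => ⟨h.1, isTame_of_avoids_theta h.1 h.2⟩, fun h => ⟨h.1, h.1.avoids_theta h.2⟩⟩


/-! ### The word of a permutation -/

/-- The word whose letter at `j` tells whether `j` is the smallest (`1`) or the largest (`-1`)
element of a nontrivial cycle, for the permutations with which we are concerned. -/
def permWord (π : Perm (Fin n)) (j : Fin n) : SignType :=
  if π j < j then -1 else if j < π.symm j then 1 else 0

theorem permWord_eq_neg_one_iff {π : Perm (Fin n)} {j : Fin n} :
    permWord π j = -1 ↔ π j < j := by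
  unfold permWord
  split_ifs <;> simp_all

theorem permWord_eq_one_iff {π : Perm (Fin n)} (h : ∀ j, π j < j → ¬ j < π.symm j) {j : Fin n} :
    permWord π j = 1 ↔ j < π.symm j := by
  have := h j
  unfold permWord
  split_ifs <;> simp_all

theorem IsTame.permWord_eq_zero_iff {π : Perm (Fin n)} (ht : IsTame π) {j : Fin n} :
    permWord π j = 0 ↔ j ≤ π j ∧ π.symm j ≤ j := by
  have := ht.1 j
  unfold permWord
  split_ifs <;> simp_all

theorem height_eq_sub (w : Fin n → SignType) (k : ℕ) :
    height 0 w k = ((Finset.univ.filter fun j : Fin n => (j : ℕ) < k ∧ w j = 1).card : ℤ) -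
      (Finset.univ.filter fun j : Fin n => (j : ℕ) < k ∧ w j = -1).card := by
  rw [height, zero_add, Finset.card_filter, Finset.card_filter]
  push_cast
  rw [← Finset.sum_sub_distrib]
  refine Finset.sum_congr rfl fun j _ => ?_
  by_cases hj : (j : ℕ) < k
  · rcases (w j).trichotomy with h | h | h <;> simp [hj, h]
  · simp [hj]

/-- Openers below `k` are the images of the closers landing below `k`; subtracting the closers below
`k` leaves those that jump down across `k`. -/
theorem height_permWord {π : Perm (Fin n)} (h : ∀ j, π j < j → ¬ j < π.symm j) (k : ℕ) :
    height 0 (permWord π) k =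
      (Finset.univ.filter fun x : Fin n => ((π x : Fin n) : ℕ) < k ∧ k ≤ x).card := by
  rw [height_eq_sub]
  simp only [permWord_eq_one_iff h, permWord_eq_neg_one_iff]
  have h1 := card_filter_apply π fun j : Fin n => (j : ℕ) < k ∧ j < π.symm j
  have h2 := Finset.card_filter_add_card_filter_not (s := Finset.univ.filter fun x : Fin n =>
    ((π x : Fin n) : ℕ) < k ∧ π x < x) (fun x => (x : ℕ) < k)
  simp only [Finset.filter_filter, not_lt, Equiv.symm_apply_apply] at h1 h2
  have h3 : (Finset.univ.filter fun x : Fin n =>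
      (((π x : Fin n) : ℕ) < k ∧ π x < x) ∧ (x : ℕ) < k) =
      Finset.univ.filter fun x : Fin n => (x : ℕ) < k ∧ π x < x :=
    Finset.filter_congr fun x _ => by lia
  have h4 : (Finset.univ.filter fun x : Fin n =>
      (((π x : Fin n) : ℕ) < k ∧ π x < x) ∧ k ≤ (x : ℕ)) =
      Finset.univ.filter fun x : Fin n => ((π x : Fin n) : ℕ) < k ∧ k ≤ x :=
    Finset.filter_congr fun x _ => by lia
  rw [h3, h4] at h2
  lia

theorem height_of_le (h : ℤ) (w : Fin n → SignType) {k : ℕ} (hk : n ≤ k) :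
    height h w k = h + ∑ j, (w j : ℤ) := by
  unfold height
  congr 1
  exact Finset.sum_congr rfl fun j _ => if_pos (j.2.trans_le hk)

theorem IsTame.isPath_permWord {π : Perm (Fin n)} (ht : IsTame π) :
    IsPath false 0 (permWord π) := by
  constructor
  · rw [← height_of_le 0 (permWord π) le_rfl, height_permWord ht.1, Nat.cast_eq_zero,
      Finset.card_eq_zero, Finset.filter_eq_empty_iff]
    intro x _
    lia
  · intro z
    rw [height_permWord ht.1]
    refine ⟨by positivity, by simp, fun hz => ?_, fun hz => ?_⟩
    · rw [permWord_eq_neg_one_iff] at hz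
      rw [Nat.cast_pos, Finset.card_pos]
      exact ⟨z, by simpa using hz⟩
    · rw [ht.permWord_eq_zero_iff] at hz
      rw [← card_crossing]
      -- By tameness an arc cannot pass strictly over a flat letter, so it can only end there, and a
      -- single arc does.
      have key : ∀ x : Fin n, (x : ℕ) < z ∧ (z : ℕ) ≤ π x → π x = z := by
        rintro x ⟨hx1, hx2⟩
        by_contra hne
        rcases ht.2 x z hx1 (lt_of_le_of_ne hx2 (Ne.symm hne)) with h | h
        · exact absurd h hz.1.not_gt
        · exact absurd h hz.2.not_gt
      have : (Finset.univ.filter fun x : Fin n => (x : ℕ) < z ∧ (z : ℕ) ≤ π x).card ≤ 1 := by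
        rw [Finset.card_le_one]
        simp only [Finset.mem_filter, Finset.mem_univ, true_and]
        exact fun x hx y hy => π.injective ((key x hx).trans (key y hy).symm)
      exact_mod_cast this

/-- The word gives the closers and their set of images, the openers; an increasing map is determined
by its domain and range, and likewise on the complements. -/
theorem permWord_injOn : Set.InjOn permWord (avoidingSet n pattern321) := by
  intro π hπ ρ hρ hw
  rw [mem_avoidingSet_iff] at hπ hρ
  have hD : ∀ j, π j < j ↔ ρ j < j := fun j => by
    rw [← permWord_eq_neg_one_iff, hw, permWord_eq_neg_one_iff]
  have hU : ∀ j, j < π.symm j ↔ j < ρ.symm j := fun j => by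
    rw [← permWord_eq_one_iff hπ.2.1, hw, permWord_eq_one_iff hρ.2.1]
  have h1 : (fun j : {j // π j < j} => π j) = fun j : {j // π j < j} => ρ j := by
    refine (StrictMono.range_inj (fun (i j : {j // π j < j}) hij => hπ.1.lt_of_lt_of_apply_lt hij i.2)
      (fun (i j : {j // π j < j}) hij => hρ.1.lt_of_lt_of_apply_lt hij ((hD i).1 i.2))).1 ?_
    ext y
    constructor
    · rintro ⟨j, rfl⟩
      refine ⟨⟨ρ.symm (π j), ?_⟩, by simp⟩
      rw [hD, Equiv.apply_symm_apply, ← hU, Equiv.symm_apply_apply]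
      exact j.2
    · rintro ⟨j, rfl⟩
      refine ⟨⟨π.symm (ρ j), ?_⟩, by simp⟩
      rw [Equiv.apply_symm_apply, hU, Equiv.symm_apply_apply, ← hD]
      exact j.2
  have h2 : (fun j : {j // ¬ π j < j} => π j) = fun j : {j // ¬ π j < j} => ρ j := by
    refine (StrictMono.range_inj
      (fun (i j : {j // ¬ π j < j}) hij => hπ.1.lt_of_lt_of_le_apply hij (not_lt.1 j.2))
      (fun (i j : {j // ¬ π j < j}) hij => hρ.1.lt_of_lt_of_le_apply hij (not_lt.1 (mt (hD j).2 j.2)))).1 ?_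
    ext y
    constructor
    · rintro ⟨j, rfl⟩
      refine ⟨⟨ρ.symm (π j), ?_⟩, by simp⟩
      rw [hD, Equiv.apply_symm_apply, ← hU, Equiv.symm_apply_apply]
      exact j.2
    · rintro ⟨j, rfl⟩
      refine ⟨⟨π.symm (ρ j), ?_⟩, by simp⟩
      rw [Equiv.apply_symm_apply, hU, Equiv.symm_apply_apply, ← hD]
      exact j.2
  ext1 j
  by_cases hj : π j < j
  · exact congrFun h1 ⟨j, hj⟩
  · exact congrFun h2 ⟨j, hj⟩

/-! ### Every path comes from a permutation -/

/-- Two subsets of the same size are matched by a permutation that is increasing on the first and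
on its complement. -/
theorem exists_perm_strictMonoOn (p q : Fin n → Prop) [DecidablePred p] [DecidablePred q]
    (h : Fintype.card {j // p j} = Fintype.card {j // q j}) :
    ∃ π : Perm (Fin n), (∀ j, q (π j) ↔ p j) ∧ StrictMonoOn π {j | p j} ∧
      StrictMonoOn π {j | ¬ p j} := by
  have h' : Fintype.card {j // ¬ p j} = Fintype.card {j // ¬ q j} := by
    rw [Fintype.card_subtype_compl, Fintype.card_subtype_compl, h]
  let e : {j // p j} ≃o {j // q j} := (monoEquivOfFin _ h).symm.trans (monoEquivOfFin _ rfl)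
  let f : {j // ¬ p j} ≃o {j // ¬ q j} := (monoEquivOfFin _ h').symm.trans (monoEquivOfFin _ rfl)
  have he : ∀ j (hj : p j), Equiv.subtypeCongr e.toEquiv f.toEquiv j = e ⟨j, hj⟩ := by
    intro j hj
    simp [Equiv.subtypeCongr, Equiv.sumCompl_symm_apply_of_pos hj]
  have hf : ∀ j (hj : ¬ p j), Equiv.subtypeCongr e.toEquiv f.toEquiv j = f ⟨j, hj⟩ := by
    intro j hj
    simp [Equiv.subtypeCongr, Equiv.sumCompl_symm_apply_of_neg hj]
  refine ⟨Equiv.subtypeCongr e.toEquiv f.toEquiv, fun j => ?_, fun i hi j hj hij => ?_,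
    fun i hi j hj hij => ?_⟩
  · by_cases hj : p j
    · rw [he j hj]
      exact ⟨fun _ => hj, fun _ => (e ⟨j, hj⟩).2⟩
    · rw [hf j hj]
      exact ⟨fun H => absurd H (f ⟨j, hj⟩).2, fun H => absurd H hj⟩
  · rw [he i hi, he j hj]
    exact e.strictMono (a := ⟨i, hi⟩) (b := ⟨j, hj⟩) hij
  · rw [hf i hi, hf j hj]
    exact f.strictMono (a := ⟨i, hi⟩) (b := ⟨j, hj⟩) hij

theorem card_lt_eq_of_strictMonoOn {π : Perm (Fin n)} {p q : Fin n → Prop} [DecidablePred p]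
    [DecidablePred q] (h : ∀ j, q (π j) ↔ p j) (hm : StrictMonoOn π {j | p j}) {x : Fin n}
    (hx : p x) :
    (Finset.univ.filter fun j => j < x ∧ p j).card =
      (Finset.univ.filter fun j => j < π x ∧ q j).card := by
  rw [← card_filter_apply π fun j => j < π x ∧ q j]
  refine congrArg Finset.card (Finset.filter_congr fun j _ => ?_)
  rw [h]
  exact and_congr_left fun hj => (hm.lt_iff_lt hj hx).symm

theorem exists_permWord_eq {w : Fin n → SignType} (hw : IsPath false 0 w) :
    ∃ π ∈ avoidingSet n pattern321, permWord π = w := by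
  have hcard : Fintype.card {j // w j = -1} = Fintype.card {j // w j = 1} := by
    have h1 := hw.1
    rw [← height_of_le 0 w le_rfl, height_eq_sub] at h1
    rw [Fintype.card_subtype, Fintype.card_subtype]
    simp only [Fin.is_lt, true_and] at h1
    lia
  obtain ⟨π, hq, hm, hm'⟩ := exists_perm_strictMonoOn (fun j => w j = -1) (fun j => w j = 1) hcard
  have hq' : ∀ j, ¬ w (π j) = 1 ↔ ¬ w j = -1 := fun j => not_congr (hq j)
  have hdown : ∀ x, w x = -1 → π x < x := by
    intro x hx
    have h1 := card_lt_eq_of_strictMonoOn (q := fun j => w j = 1) hq hm hx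
    have h2 := (hw.2 x).2.2.1 hx
    rw [height_eq_sub] at h2
    -- Positive height before `x` means more up than down steps precede it, so the up step of equal
    -- rank comes earlier.
    by_contra! hc
    have h3 : (Finset.univ.filter fun j : Fin n => j < x ∧ w j = 1).card ≤
        (Finset.univ.filter fun j : Fin n => j < π x ∧ w j = 1).card :=
      Finset.card_le_card
        (Finset.monotone_filter_right _ fun j _ hj => ⟨hj.1.trans_le hc, hj.2⟩)
    simp only [Fin.val_fin_lt] at h2
    lia
  have hup : ∀ x, w x ≠ -1 → x ≤ π x := by
    intro x hx
    have h1 := card_lt_eq_of_strictMonoOn (q := fun j => ¬ w j = 1) hq' hm' hx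
    have h2 := (hw.2 x).1
    rw [height_eq_sub] at h2
    have h3 := Finset.card_filter_add_card_filter_not
      (s := Finset.univ.filter fun j => j < x) (fun j => w j = 1)
    have h4 := Finset.card_filter_add_card_filter_not
      (s := Finset.univ.filter fun j => j < x) (fun j => w j = -1)
    simp only [Finset.filter_filter] at h3 h4
    -- Here `π x` is itself a non-up letter below `x`, so fewer up than down steps would precede
    -- `x`, making the height negative.
    by_contra! hc
    have h5 : (Finset.univ.filter fun j => j < π x ∧ ¬ w j = 1).card <
        (Finset.univ.filter fun j => j < x ∧ ¬ w j = 1).card := by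
      refine Finset.card_lt_card ((Finset.ssubset_iff_of_subset ?_).2 ⟨π x, ?_, ?_⟩)
      · exact Finset.monotone_filter_right _ fun j _ hj => ⟨hj.1.trans hc, hj.2⟩
      · simpa [hc] using (hq' x).2 hx
      · simp
    simp only [Fin.val_fin_lt] at h2
    lia
  have hdown' : ∀ x, π x < x ↔ w x = -1 := fun x =>
    ⟨fun h => by_contra fun h' => absurd h (hup x h').not_gt, hdown x⟩
  have hup' : ∀ x, x < π.symm x ↔ w x = 1 := by
    intro x
    have h := hq (π.symm x)
    rw [Equiv.apply_symm_apply] at h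
    rw [h, ← hdown', Equiv.apply_symm_apply]
  have hword : permWord π = w := by
    funext j
    unfold permWord
    simp only [hdown', hup']
    rcases (w j).trichotomy with h | h | h <;> simp [h]
  have hdec : NoDecreasing π := by
    intro i j k hij hjk hkj hji
    -- Two of three letters lie in the same class, on which `π` is increasing.
    by_cases hi : w i = -1 <;> by_cases hj : w j = -1 <;> by_cases hk : w k = -1
    · exact absurd (hm hi hj hij) hji.not_gt
    · exact absurd (hm hi hj hij) hji.not_gt
    · exact absurd (hm hi hk (hij.trans hjk)) (hkj.trans hji).not_gt
    · exact absurd (hm' hj hk hjk) hkj.not_gt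
    · exact absurd (hm hj hk hjk) hkj.not_gt
    · exact absurd (hm' hi hk (hij.trans hjk)) (hkj.trans hji).not_gt
    · exact absurd (hm' hi hj hij) hji.not_gt
    · exact absurd (hm' hi hj hij) hji.not_gt
  have htame1 : ∀ j, π j < j → ¬ j < π.symm j := by
    intro j h1 h2
    rw [hdown'] at h1
    rw [hup', h1] at h2
    exact absurd h2 (by decide)
  refine ⟨π, mem_avoidingSet_iff.2 ⟨hdec, htame1, fun x z hxz hzx => ?_⟩, hword⟩
  by_contra! hc
  obtain ⟨hc1, hc2⟩ := hc
  have hz : w z = 0 := by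
    rw [← not_lt, hdown'] at hc1
    rw [← not_lt, hup'] at hc2
    rcases (w z).trichotomy with h | h | h <;> simp_all
  have h1 := (hw.2 z).2.2.2 hz
  rw [← hword, height_permWord htame1, ← card_crossing, Nat.cast_le_one, Finset.card_le_one] at h1
  have h2 : π x < π z := hdec.lt_of_lt_of_le_apply hxz hc1
  have h3 : π.symm z ≠ z := by
    intro he
    rw [Equiv.symm_apply_eq] at he
    exact absurd (hzx.trans (he ▸ h2)) (lt_irrefl _)
  -- Both `x` and `π⁻¹ z` cross upward at the flat letter `z`, where the height is at most 1, so
  -- they coincide.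
  have h4 := h1 x (by simpa using ⟨hxz, hzx.le⟩) (π.symm z)
    (by simpa using lt_of_le_of_ne hc2 h3)
  rw [h4, Equiv.apply_symm_apply] at hzx
  exact absurd hzx (lt_irrefl _)

theorem image_permWord :
    permWord '' avoidingSet n pattern321 = {w | IsPath false 0 w} := by
  ext w
  constructor
  · rintro ⟨π, hπ, rfl⟩
    exact (mem_avoidingSet_iff.1 hπ).2.isPath_permWord
  · intro hw
    obtain ⟨π, hπ, h⟩ := exists_permWord_eq hw
    exact ⟨π, hπ, h⟩

theorem t_pattern321 (n : ℕ) : t n pattern321 = pathCount false n 0 := by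
  rw [t, ← permWord_injOn.ncard_image, image_permWord, ← natCard_isPath,
    ← Nat.card_coe_set_eq]
  rfl

/-! ### Irreducible permutations -/

theorem directSum_castAdd {a b : ℕ} (σ : Perm (Fin a)) (τ : Perm (Fin b)) (x : Fin a) :
    directSum σ τ (Fin.castAdd b x) = Fin.castAdd b (σ x) := by
  simp [directSum, Equiv.permCongr_apply]

theorem reducible_iff (π : Perm (Fin n)) :
    Reducible π ↔ ∃ k : Fin n, (k : ℕ) ≠ 0 ∧ ∀ x, x < k → π x < k := by
  constructor
  · rintro ⟨a, b, rfl, σ, τ, ha, hb, rfl⟩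
    refine ⟨⟨a, by lia⟩, by simp; lia, fun x hx => ?_⟩
    obtain ⟨y, rfl⟩ : ∃ y, x = Fin.castAdd b y := ⟨⟨x, hx⟩, rfl⟩
    have : (finCongr rfl).permCongr (directSum σ τ) = directSum σ τ := rfl
    rw [this, directSum_castAdd]
    exact (σ y).2
  · rintro ⟨⟨k, hkn⟩, hk0, hk⟩
    obtain ⟨b, rfl⟩ := Nat.exists_eq_add_of_le hkn.le
    have hmem : (finSumFinEquiv (m := k) (n := b)).symm.permCongr π ∈
        (Perm.sumCongrHom (Fin k) (Fin b)).range := by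
      refine Perm.mem_sumCongrHom_range_of_perm_mapsTo_inl ?_
      rintro _ ⟨x, rfl⟩
      have hx : π (Fin.castAdd b x) < ⟨k, hkn⟩ := hk _ x.2
      refine ⟨⟨π (Fin.castAdd b x), hx⟩, ?_⟩
      apply finSumFinEquiv.injective
      simp [Equiv.permCongr_apply]
    obtain ⟨⟨σ, τ⟩, h⟩ := hmem
    refine ⟨k, b, rfl, σ, τ, Nat.one_le_iff_ne_zero.2 hk0, by lia, ?_⟩
    change π = finSumFinEquiv.permCongr (Perm.sumCongr σ τ)
    have h' : Perm.sumCongr σ τ = (finSumFinEquiv (m := k) (n := b)).symm.permCongr π := h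
    rw [h']
    ext x
    simp [Equiv.permCongr_apply]

theorem IsTame.not_reducible_iff {π : Perm (Fin n)} (ht : IsTame π) :
    ¬ Reducible π ↔ ∀ k : Fin n, (k : ℕ) ≠ 0 → 0 < height 0 (permWord π) k := by
  rw [reducible_iff]
  push Not
  refine forall_congr' fun k => imp_congr_right fun _ => ?_
  rw [height_permWord ht.1, ← card_crossing, Nat.cast_pos, Finset.card_pos]
  simp [Finset.Nonempty]

theorem irreducibleCount_pattern321 (n : ℕ) :
    irreducibleCount (n + 2) pattern321 = n.choose (n / 2) := by
  have himage : permWord '' {π ∈ avoidingSet (n + 2) pattern321 | ¬ Reducible π} =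
      {w | IsPath false 0 w ∧ ∀ i : Fin (n + 2), i ≠ 0 → 0 < height 0 w i} := by
    ext w
    constructor
    · rintro ⟨π, ⟨hπ, hr⟩, rfl⟩
      have ht := (mem_avoidingSet_iff.1 hπ).2
      exact ⟨ht.isPath_permWord, fun i hi => ht.not_reducible_iff.1 hr i (by simpa using hi)⟩
    · rintro ⟨hw, hpos⟩
      obtain ⟨π, hπ, rfl⟩ := exists_permWord_eq hw
      have ht := (mem_avoidingSet_iff.1 hπ).2
      exact ⟨π, ⟨hπ, ht.not_reducible_iff.2 fun i hi => hpos i (by simpa using hi)⟩, rfl⟩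
  rw [irreducibleCount, ← (permWord_injOn.mono fun π hπ => hπ.1).ncard_image, himage,
    ← natCard_isPath_and_pos, ← Nat.card_coe_set_eq]
  rfl

theorem genFun_pattern321 : genFun pattern321 = pathSeries - 1 := by
  ext n
  rcases n with _ | n
  · simp [genFun, pathSeries, pathCount]
  · simp [genFun, pathSeries, t_pattern321, PowerSeries.coeff_one]

end FundamentalBijection

theorem mainTheorem1 :
    (∃ S : PowerSeries ℚ,
      (PowerSeries.constantCoeff S = 1 ∧ S ^ 2 = 1 - 4 * PowerSeries.X ^ 2) ∧
      2 * PowerSeries.X * (1 - PowerSeries.X) - 1 + S ≠ 0 ∧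
      ((FundamentalBijection.genFun FundamentalBijection.pattern321 : PowerSeries ℚ) :
          LaurentSeries ℚ) =
        ((2 * PowerSeries.X ^ 2 : PowerSeries ℚ) : LaurentSeries ℚ) /
          ((2 * PowerSeries.X * (1 - PowerSeries.X) - 1 + S : PowerSeries ℚ) :
            LaurentSeries ℚ)) ∧
    (∀ n : ℕ, 2 ≤ n →
      FundamentalBijection.irreducibleCount n FundamentalBijection.pattern321 =
        Nat.choose (n - 2) ((n - 2) / 2)) := by
  open FundamentalBijection in
  have hmul := pathSeries_sub_one_mul
  have hne : 2 * PowerSeries.X * (1 - PowerSeries.X) - 1 + sqrtSeries ≠ 0 := by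
    intro h
    rw [h, mul_zero] at hmul
    -- A zero denominator would force `2x² = 0`.
    have := congrArg (PowerSeries.coeff 2) hmul
    rw [← map_ofNat (PowerSeries.C (R := ℚ)) 2, PowerSeries.coeff_C_mul,
      PowerSeries.coeff_X_pow_self] at this
    norm_num at this
  refine ⟨⟨sqrtSeries, ⟨constantCoeff_sqrtSeries, sqrtSeries_sq⟩, hne, ?_⟩, fun n hn => ?_⟩
  · have hne' : ((2 * PowerSeries.X * (1 - PowerSeries.X) - 1 + sqrtSeries : PowerSeries ℚ) :
        LaurentSeries ℚ) ≠ 0 := by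
      rw [← PowerSeries.coe_zero]
      exact fun h => hne (HahnSeries.ofPowerSeries_injective h)
    rw [eq_div_iff hne', genFun_pattern321, ← PowerSeries.coe_mul, hmul]
  · obtain ⟨m, rfl⟩ := Nat.exists_eq_add_of_le' hn
    exact irreducibleCount_pattern321 m
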